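/- Let $X$ be a separable real Banach space that contains a linear subspace isomorphic to $\ell_1$. Then there is an equivalent norm on $X$ such that, when the bidual $X^{**}$ carries the corresponding bidual norm, $B_{X^{**}}$ denotes its closed unit ball, and $b(X^{**})_1$ denotes the restriction to $B_{X^{**}}$ of the ball topology of $X^{**}$ (the coarsest topology on $X^{**}$ in which every norm-closed ball of $X^{**}$ is closed), the following holds: the topology $b(X^{**})_1$ is not Hausdorff and, moreover, every two nonempty $b(X^{**})_1$-open subsets of $B_{X^{**}}$ have nonempty intersection. -/

import Mathlib

open scoped Topology

noncomputable section

/-- An equivalent norm on the real normed space `X`: a seminorm `p` on `X` with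
`c ‖x‖ ≤ p x ≤ C ‖x‖` for some constants `c, C > 0` (so `p` is a norm). -/
structure EquivalentNorm (X : Type*) [NormedAddCommGroup X] [NormedSpace ℝ X]
    extends Seminorm ℝ X where
  exists_lower : ∃ c : ℝ, 0 < c ∧ ∀ x : X, c * ‖x‖ ≤ toSeminorm x
  exists_upper : ∃ C : ℝ, 0 < C ∧ ∀ x : X, toSeminorm x ≤ C * ‖x‖

/-- The vector space `X` equipped with the equivalent norm `p` instead of its original norm. -/
def Renormed {X : Type*} [NormedAddCommGroup X] [NormedSpace ℝ X]
    (_p : EquivalentNorm X) : Type _ := X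

namespace Renormed

variable {X : Type*} [NormedAddCommGroup X] [NormedSpace ℝ X] (p : EquivalentNorm X)

instance : AddCommGroup (Renormed p) := inferInstanceAs (AddCommGroup X)

instance : Module ℝ (Renormed p) := inferInstanceAs (Module ℝ X)

/-- The identity map, regarded as a linear isomorphism from `X` to the renormed space. -/
def equiv : X ≃ₗ[ℝ] Renormed p where
  toFun x := x
  invFun x := x
  map_add' _ _ := rfl
  map_smul' _ _ := rfl

/-- The new norm, bundled as a group norm. -/
def groupNorm : AddGroupNorm (Renormed p) where
  toFun x := p.toSeminorm ((equiv p).symm x)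
  map_zero' := by simp
  add_le' x y := by rw [map_add]; exact map_add_le_add p.toSeminorm _ _
  neg' x := by rw [map_neg]; exact map_neg_eq_map p.toSeminorm _
  eq_zero_of_map_eq_zero' := by
    intro x hx
    obtain ⟨c, hc, h⟩ := p.exists_lower
    have h1 : c * ‖(equiv p).symm x‖ ≤ 0 := (h _).trans_eq hx
    have h2 : ‖(equiv p).symm x‖ ≤ 0 := nonpos_of_mul_nonpos_right h1 hc
    exact (equiv p).symm.map_eq_zero_iff.1 (norm_le_zero_iff.1 h2)

instance : NormedAddCommGroup (Renormed p) :=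
  AddGroupNorm.toNormedAddCommGroup (groupNorm p)

/-- The norm of `Renormed p` is `p`. -/
theorem norm_equiv (x : X) : ‖equiv p x‖ = p.toSeminorm x := rfl

instance : NormedSpace ℝ (Renormed p) where
  norm_smul_le a x := (map_smul_eq_mul p.toSeminorm a ((equiv p).symm x)).le

end Renormed

/-- `X` contains a (linear) subspace isomorphic, as a topological vector space, to the real
space `ℓ₁` of absolutely summable sequences. -/
def ContainsEllOne (X : Type*) [NormedAddCommGroup X] [NormedSpace ℝ X] : Prop :=
  ∃ Y : Submodule ℝ X, Nonempty (Y ≃L[ℝ] lp (fun _ : ℕ => ℝ) 1)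

/-- The ball topology of `E`: the coarsest topology in which all norm closed balls are closed. -/
@[reducible]
def ballTopology (E : Type*) [NormedAddCommGroup E] : TopologicalSpace E :=
  TopologicalSpace.generateFrom {U : Set E | ∃ (x : E) (r : ℝ), U = (Metric.closedBall x r)ᶜ}

/-- The ball topology of `E` restricted to the closed unit ball of `E`. -/
@[reducible]
def unitBallTopology (E : Type*) [NormedAddCommGroup E] :
    TopologicalSpace (Metric.closedBall (0 : E) 1) :=
  TopologicalSpace.induced Subtype.val (ballTopology E)

/-- The bidual, with its bidual norm. -/
abbrev Bidual (X : Type*) [NormedAddCommGroup X] [NormedSpace ℝ X] : Type _ :=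
  StrongDual ℝ (StrongDual ℝ X)

end

noncomputable section

/-! The aim is a norm with vectors `v k` in its unit ball such that every `f` in the dual ball is a
weak limit of functionals `g k` in the dual ball with `g k (v k) = 1` (`HasPeakingSequence`). For
`x` in the bidual, `‖v k - x‖ ≥ 1 - x (g k) → 1 - x f`, and `-x f` can be taken close to `‖x‖`. So
finitely many balls with radii `r < ‖x‖ + 1` never cover the unit ball, not even jointly
(`exists_far`). Basic open sets are complements of such finite unions, hence any two nonempty open
sets meet.

Weak convergence comes from an upper `ℓ₂`-estimate on `g k - f`. Extend the sign functionals of `ℓ₁`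
to `X` and average them against Riesz products with coefficients `a`: the result takes the value `a
n` at the `n`-th basis vector. Changing single coefficients multiplies the density by increments
orthogonal in `L₂`, which gives the estimate (`exists_rieszFunctionals`).

The new dual ball consists of the `f` below a small multiple of the norm plus the supremum of the
family, with `|f| ≤ 1/4` on the basis. By Hahn–Banach such an `f` is a small functional plus a mean
of the family; changing the `k`-th coefficient under the mean raises the `k`-th value to `1/4` and
leaves the others alone (`exists_modified`). -/

/-- The sign `±1` attached to a Boolean. -/
def boolSign (b : Bool) : ℝ := if b then 1 else -1

theorem boolSign_mul_self (b : Bool) : boolSign b * boolSign b = 1 := by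
  cases b <;> simp [boolSign]

theorem abs_boolSign (b : Bool) : |boolSign b| = 1 := by
  cases b <;> simp [boolSign]

/-! ### Riesz products on the finite cube -/

section RieszWeight

variable {ι : Type*} [Fintype ι]

/-- The density of the Riesz product with coefficients `a` on the discrete cube. -/
def rieszWeight (a : ι → ℝ) (t : ι → Bool) : ℝ :=
  ∏ i, (1 + a i * boolSign (t i)) / 2

theorem half_le_one_add_mul_boolSign {c : ℝ} (hc : |c| ≤ 1 / 2) (b : Bool) :
    1 / 2 ≤ 1 + c * boolSign b := by
  rw [abs_le] at hc
  cases b <;> simp [boolSign] <;> linarith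

theorem rieszWeight_nonneg {a : ι → ℝ} (ha : ∀ i, |a i| ≤ 1 / 2) (t : ι → Bool) :
    0 ≤ rieszWeight a t :=
  Finset.prod_nonneg fun i _ => by
    have := half_le_one_add_mul_boolSign (ha i) (t i)
    linarith

variable [DecidableEq ι]

theorem sum_rieszWeight (a : ι → ℝ) : ∑ t, rieszWeight a t = 1 := by
  have h := Finset.prod_univ_sum (fun _ : ι => (Finset.univ : Finset Bool))
    (fun i b => (1 + a i * boolSign b) / 2)
  rw [Fintype.piFinset_univ] at h
  unfold rieszWeight
  rw [← h]
  refine Finset.prod_eq_one fun i _ => ?_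
  simp [boolSign]
  ring

/-- The relative increment of the Riesz product when the coefficient `a` becomes `c`. -/
def rieszIncrement (a c : ℝ) (b : Bool) : ℝ := (c - a) * boolSign b / (1 + a * boolSign b)

theorem abs_rieszIncrement_le {a c : ℝ} (ha : |a| ≤ 1 / 2) (hc : |c| ≤ 1 / 2) (b : Bool) :
    |rieszIncrement a c b| ≤ 2 := by
  have h := half_le_one_add_mul_boolSign ha b
  have h1 : |c - a| ≤ 1 := (abs_sub c a).trans (by linarith)
  rw [rieszIncrement, abs_div, abs_mul, abs_boolSign, mul_one,
    abs_of_pos (by linarith : 0 < 1 + a * boolSign b), div_le_iff₀ (by linarith)]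
  linarith

theorem rieszWeight_mul_rieszIncrement {a : ι → ℝ} (ha : ∀ i, |a i| ≤ 1 / 2) (k : ι) (c : ℝ)
    (t : ι → Bool) :
    rieszWeight a t * rieszIncrement (a k) c (t k) =
      rieszWeight (Function.update a k c) t - rieszWeight a t := by
  have h := half_le_one_add_mul_boolSign (ha k) (t k)
  have h0 : 1 + a k * boolSign (t k) ≠ 0 := by linarith
  have hr : ∏ i ∈ Finset.univ.erase k, (1 + Function.update a k c i * boolSign (t i)) / 2 =
      ∏ i ∈ Finset.univ.erase k, (1 + a i * boolSign (t i)) / 2 :=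
    Finset.prod_congr rfl fun i hi => by
      rw [Function.update_of_ne (Finset.ne_of_mem_erase hi)]
  unfold rieszWeight rieszIncrement
  rw [← Finset.mul_prod_erase _ _ (Finset.mem_univ k),
    ← Finset.mul_prod_erase _ _ (Finset.mem_univ k), hr, Function.update_self]
  field_simp
  ring

/-- The summand is a mixed second difference of Riesz weights, each of total mass one, so the sum is
`1 - 1 - (1 - 1)`. -/
theorem sum_rieszWeight_mul_rieszIncrement_mul {a c : ι → ℝ} (ha : ∀ i, |a i| ≤ 1 / 2)
    (hc : ∀ i, |c i| ≤ 1 / 2) {k j : ι} (hkj : k ≠ j) :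
    ∑ t, rieszWeight a t *
      (rieszIncrement (a k) (c k) (t k) * rieszIncrement (a j) (c j) (t j)) = 0 := by
  have ha' : ∀ i, |Function.update a k (c k) i| ≤ 1 / 2 := by
    intro i
    rcases eq_or_ne i k with rfl | hi
    · simpa using hc i
    · simpa [hi] using ha i
  have h : ∀ t : ι → Bool, rieszWeight a t *
      (rieszIncrement (a k) (c k) (t k) * rieszIncrement (a j) (c j) (t j)) =
      (rieszWeight (Function.update (Function.update a k (c k)) j (c j)) t
        - rieszWeight (Function.update a k (c k)) t)
      - (rieszWeight (Function.update a j (c j)) t - rieszWeight a t) := by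
    intro t
    rw [← rieszWeight_mul_rieszIncrement ha', ← rieszWeight_mul_rieszIncrement ha,
      Function.update_of_ne hkj.symm, ← mul_assoc, rieszWeight_mul_rieszIncrement ha]
    ring
  simp only [h, Finset.sum_sub_distrib, sum_rieszWeight]
  ring

theorem sum_rieszWeight_mul_boolSign {a : ι → ℝ} (ha : ∀ i, |a i| ≤ 1 / 2) (k : ι) :
    ∑ t, rieszWeight a t * boolSign (t k) = a k := by
  have hb : ∀ i, |Function.update a k 0 i| ≤ 1 / 2 := by
    intro i
    rcases eq_or_ne i k with rfl | hi
    · simp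
    · simpa [hi] using ha i
  have h : ∀ c t, rieszWeight (Function.update a k 0) t * (c * boolSign (t k)) =
      rieszWeight (Function.update a k c) t - rieszWeight (Function.update a k 0) t := by
    intro c t
    simpa [rieszIncrement] using rieszWeight_mul_rieszIncrement hb k c t
  -- If `w` is the weight with `k`-th coefficient `0`, the full weight is `w (1 + a k s)` with `s =
  -- ±1`. Multiplying by `s` gives `a k w + w s`, and `w s` is the change of `w` when that
  -- coefficient becomes `1`.
  have h' : ∀ t, rieszWeight a t * boolSign (t k) =
      a k * rieszWeight (Function.update a k 0) t +
        (rieszWeight (Function.update a k 1) t - rieszWeight (Function.update a k 0) t) := by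
    intro t
    have h1 := h (a k) t
    rw [Function.update_eq_self] at h1
    rw [← h 1, eq_add_of_sub_eq h1.symm]
    linear_combination a k * rieszWeight (Function.update a k 0) t * boolSign_mul_self (t k)
  simp only [h', Finset.sum_add_distrib, Finset.sum_sub_distrib, ← Finset.mul_sum,
    sum_rieszWeight]
  ring

/-- Orthogonality of the increments of a Riesz product, in integrated form. -/
theorem sum_rieszWeight_mul_abs_le {a c : ι → ℝ} (ha : ∀ i, |a i| ≤ 1 / 2)
    (hc : ∀ i, |c i| ≤ 1 / 2) (σ : ι → ℝ) :
    ∑ t, rieszWeight a t * |∑ k, σ k * rieszIncrement (a k) (c k) (t k)| ≤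
      2 * √(∑ k, σ k ^ 2) := by
  have hsq : ∑ t, rieszWeight a t * (∑ k, σ k * rieszIncrement (a k) (c k) (t k)) ^ 2 ≤
      4 * ∑ k, σ k ^ 2 := by
    calc ∑ t, rieszWeight a t * (∑ k, σ k * rieszIncrement (a k) (c k) (t k)) ^ 2
        = ∑ k, ∑ j, σ k * σ j * ∑ t, rieszWeight a t *
            (rieszIncrement (a k) (c k) (t k) * rieszIncrement (a j) (c j) (t j)) := by
          simp_rw [sq, Finset.sum_mul_sum, Finset.mul_sum]
          rw [Finset.sum_comm]
          refine Finset.sum_congr rfl fun k _ => ?_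
          rw [Finset.sum_comm]
          exact Finset.sum_congr rfl fun j _ => Finset.sum_congr rfl fun t _ => by ring
      _ = ∑ k, σ k ^ 2 * ∑ t, rieszWeight a t * rieszIncrement (a k) (c k) (t k) ^ 2 := by
          refine Finset.sum_congr rfl fun k _ => ?_
          rw [Finset.sum_eq_single k]
          · simp only [sq]
          · intro j _ hj
            rw [sum_rieszWeight_mul_rieszIncrement_mul ha hc hj.symm, mul_zero]
          · simp
      _ ≤ ∑ k, σ k ^ 2 * 4 := by
          gcongr with k _
          calc ∑ t, rieszWeight a t * rieszIncrement (a k) (c k) (t k) ^ 2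
              ≤ ∑ t, rieszWeight a t * 4 := by
                gcongr with t _
                · exact rieszWeight_nonneg ha t
                · have := abs_rieszIncrement_le (ha k) (hc k) (t k)
                  rw [← sq_abs]
                  nlinarith [abs_nonneg (rieszIncrement (a k) (c k) (t k))]
            _ = 4 := by rw [← Finset.sum_mul, sum_rieszWeight, one_mul]
      _ = 4 * ∑ k, σ k ^ 2 := by rw [← Finset.sum_mul, mul_comm]
  -- Cauchy–Schwarz for a probability weight: the `L₁` norm is at most the `L₂` norm.
  have hcs := Finset.sum_sq_le_sum_mul_sum_of_sq_le_mul Finset.univ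
    (r := fun t => rieszWeight a t * |∑ k, σ k * rieszIncrement (a k) (c k) (t k)|)
    (f := fun t => rieszWeight a t)
    (g := fun t => rieszWeight a t * (∑ k, σ k * rieszIncrement (a k) (c k) (t k)) ^ 2)
    (fun t _ => rieszWeight_nonneg ha t)
    (fun t _ => mul_nonneg (rieszWeight_nonneg ha t) (sq_nonneg _))
    (fun t _ => le_of_eq (by rw [mul_pow, sq_abs]; ring))
  rw [sum_rieszWeight, one_mul] at hcs
  refine (Real.le_sqrt_of_sq_le (hcs.trans hsq)).trans_eq ?_
  rw [Real.sqrt_mul (by norm_num), show (4 : ℝ) = 2 ^ 2 by norm_num, Real.sqrt_sq (by norm_num)]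

variable {E : Type*} [NormedAddCommGroup E] [NormedSpace ℝ E]

theorem norm_sum_rieszWeight_smul_le {a : ι → ℝ} (ha : ∀ i, |a i| ≤ 1 / 2) {C : ℝ}
    {f : (ι → Bool) → E} (hf : ∀ t, ‖f t‖ ≤ C) : ‖∑ t, rieszWeight a t • f t‖ ≤ C := by
  calc ‖∑ t, rieszWeight a t • f t‖ ≤ ∑ t, rieszWeight a t * C := by
        refine norm_sum_le_of_le _ fun t _ => ?_
        rw [norm_smul, Real.norm_of_nonneg (rieszWeight_nonneg ha t)]
        exact mul_le_mul_of_nonneg_left (hf t) (rieszWeight_nonneg ha t)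
    _ = C := by rw [← Finset.sum_mul, sum_rieszWeight, one_mul]

/-- Changing single coefficients of a Riesz product produces increments with an upper
`ℓ₂`-estimate. -/
theorem norm_sum_smul_rieszWeight_update_sub_le {a c : ι → ℝ} (ha : ∀ i, |a i| ≤ 1 / 2)
    (hc : ∀ i, |c i| ≤ 1 / 2) (σ : ι → ℝ) {C : ℝ} (hC : 0 ≤ C) {f : (ι → Bool) → E}
    (hf : ∀ t, ‖f t‖ ≤ C) :
    ‖∑ k, σ k • (∑ t, rieszWeight (Function.update a k (c k)) t • f t
      - ∑ t, rieszWeight a t • f t)‖ ≤ 2 * C * √(∑ k, σ k ^ 2) := by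
  have h : ∑ k, σ k • (∑ t, rieszWeight (Function.update a k (c k)) t • f t
      - ∑ t, rieszWeight a t • f t) =
      ∑ t, (rieszWeight a t * ∑ k, σ k * rieszIncrement (a k) (c k) (t k)) • f t := by
    simp only [← Finset.sum_sub_distrib, ← sub_smul, ← rieszWeight_mul_rieszIncrement ha,
      Finset.smul_sum, smul_smul, Finset.mul_sum, Finset.sum_smul]
    rw [Finset.sum_comm]
    exact Finset.sum_congr rfl fun t _ => Finset.sum_congr rfl fun k _ => by congr 1; ring
  rw [h]
  calc _ ≤ ∑ t, rieszWeight a t * |∑ k, σ k * rieszIncrement (a k) (c k) (t k)| * C := by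
        refine norm_sum_le_of_le _ fun t _ => ?_
        rw [norm_smul, norm_mul, Real.norm_of_nonneg (rieszWeight_nonneg ha t), Real.norm_eq_abs]
        exact mul_le_mul_of_nonneg_left (hf t)
          (mul_nonneg (rieszWeight_nonneg ha t) (abs_nonneg _))
    _ ≤ 2 * √(∑ k, σ k ^ 2) * C := by
        rw [← Finset.sum_mul]
        exact mul_le_mul_of_nonneg_right (sum_rieszWeight_mul_abs_le ha hc σ) hC
    _ = _ := by ring

end RieszWeight

/-! ### Riesz averages of functionals on a space containing `ℓ₁` -/

/-- The functional `y ↦ ∑ ± y n` on `ℓ₁` given by a sequence of signs. -/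
def signFunctional (t : ℕ → Bool) : StrongDual ℝ (lp (fun _ : ℕ => ℝ) 1) :=
  LinearMap.mkContinuous
    { toFun := fun y => ∑' n, boolSign (t n) * y n
      map_add' := fun y z => by
        have hy : Summable fun n => boolSign (t n) * y n := by
          refine .of_norm ?_
          simpa [abs_mul, abs_boolSign] using y.2.summable (by simp)
        have hz : Summable fun n => boolSign (t n) * z n := by
          refine .of_norm ?_
          simpa [abs_mul, abs_boolSign] using z.2.summable (by simp)
        rw [← hy.tsum_add hz]
        simp [mul_add]
      map_smul' := fun r y => by
        simp [mul_left_comm _ r, tsum_mul_left] }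
    1 fun y => by
      have hy : Summable fun n => ‖boolSign (t n) * y n‖ := by
        simpa [abs_mul, abs_boolSign] using y.2.summable (by simp)
      have hn : ‖y‖ = ∑' n, |y n| := by
        simpa using lp.norm_eq_tsum_rpow (by simp) y
      refine (norm_tsum_le_tsum_norm hy).trans_eq ?_
      simp [hn, abs_boolSign]

theorem signFunctional_apply (t : ℕ → Bool) (y : lp (fun _ : ℕ => ℝ) 1) :
    signFunctional t y = ∑' n, boolSign (t n) * y n := rfl

theorem signFunctional_single (t : ℕ → Bool) (n : ℕ) :
    signFunctional t (lp.single 1 n 1) = boolSign (t n) := by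
  rw [signFunctional_apply, tsum_eq_single n]
  · simp
  · intro m hm
    simp [hm]

theorem norm_signFunctional_le (t : ℕ → Bool) : ‖signFunctional t‖ ≤ 1 :=
  LinearMap.mkContinuous_norm_le _ zero_le_one _

section RieszAverage

variable {X : Type*} [NormedAddCommGroup X] [NormedSpace ℝ X]

theorem ContainsEllOne.exists_signs (hX : ContainsEllOne X) :
    ∃ (e : ℕ → X) (f : (ℕ → Bool) → StrongDual ℝ X) (C : ℝ),
      (∀ n, ‖e n‖ ≤ C) ∧ (∀ t, ‖f t‖ ≤ C) ∧ ∀ t n, f t (e n) = boolSign (t n) := by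
  obtain ⟨Y, ⟨Φ⟩⟩ := hX
  choose f hf hfn using fun t : ℕ → Bool => exists_extension_norm_eq Y
    ((signFunctional t).comp (Φ : Y →L[ℝ] lp (fun _ : ℕ => ℝ) 1))
  refine ⟨fun n => (Φ.symm (lp.single 1 n 1) : Y), f,
    max ‖(Φ.symm : lp (fun _ : ℕ => ℝ) 1 →L[ℝ] Y)‖ ‖(Φ : Y →L[ℝ] lp (fun _ : ℕ => ℝ) 1)‖,
    fun n => le_max_of_le_left ?_, fun t => le_max_of_le_right ?_, fun t n => ?_⟩
  · refine ((Φ.symm : lp (fun _ : ℕ => ℝ) 1 →L[ℝ] Y).le_opNorm (lp.single 1 n 1)).trans_eq ?_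
    rw [lp.norm_single (by simp), norm_one, mul_one]
  · rw [hfn]
    refine (ContinuousLinearMap.opNorm_comp_le _ _).trans ?_
    exact mul_le_of_le_one_left (norm_nonneg _) (norm_signFunctional_le t)
  · rw [hf]
    simp [signFunctional_single]

/-- A bounded sequence of functionals converges pointwise along a nonprincipal ultrafilter. -/
theorem exists_tendsto_hyperfilter {C : ℝ} (g : ℕ → StrongDual ℝ X) (hg : ∀ N, ‖g N‖ ≤ C) :
    ∃ f : StrongDual ℝ X, ‖f‖ ≤ C ∧
      ∀ x, Filter.Tendsto (fun N => g N x) (Filter.hyperfilter ℕ) (𝓝 (f x)) := by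
  have hK := WeakDual.isCompact_closedBall (𝕜 := ℝ) (0 : StrongDual ℝ X) C
  obtain ⟨f, hf, hle⟩ := hK.ultrafilter_le_nhds
    ((Filter.hyperfilter ℕ).map fun N => StrongDual.toWeakDual (g N)) (by
      rw [Filter.le_principal_iff, Ultrafilter.mem_coe, Ultrafilter.mem_map]
      exact Filter.univ_mem' fun N => mem_closedBall_zero_iff.2 (hg N))
  refine ⟨WeakDual.toStrongDual f, mem_closedBall_zero_iff.1 hf, fun x => ?_⟩
  exact ((WeakDual.eval_continuous x).tendsto f).comp hle

/-- The index set of coefficients of Riesz products. -/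
abbrev RieszCoeff : Type := ℕ → Set.Icc (-(1 / 2) : ℝ) (1 / 2)

theorem RieszCoeff.abs_le (a : RieszCoeff) (n : ℕ) : |(a n : ℝ)| ≤ 1 / 2 :=
  _root_.abs_le.2 (a n).2

/-- Extend a finite sequence of Booleans by `true`. -/
def extendTrue {N : ℕ} (t : Fin N → Bool) (n : ℕ) : Bool :=
  if h : n < N then t ⟨n, h⟩ else true

theorem coe_update_comp_val {N : ℕ} (a : RieszCoeff) (k : Fin N)
    (c : Set.Icc (-(1 / 2) : ℝ) (1 / 2)) :
    (fun i : Fin N => (Function.update a (k : ℕ) c i : ℝ)) =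
      Function.update (fun i : Fin N => (a i : ℝ)) k (c : ℝ) := by
  ext i
  rcases eq_or_ne i k with rfl | h
  · simp
  · rw [Function.update_of_ne h, Function.update_of_ne (Fin.val_injective.ne h)]

/-- Averages of functionals with respect to the Riesz product on the first `N` coordinates. -/
def rieszAverage (f : (ℕ → Bool) → StrongDual ℝ X) (a : RieszCoeff) (N : ℕ) : StrongDual ℝ X :=
  ∑ t : Fin N → Bool, rieszWeight (fun i : Fin N => (a i : ℝ)) t • f (extendTrue t)

theorem norm_rieszAverage_le {f : (ℕ → Bool) → StrongDual ℝ X} {C : ℝ} (hf : ∀ t, ‖f t‖ ≤ C)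
    (a : RieszCoeff) (N : ℕ) : ‖rieszAverage f a N‖ ≤ C :=
  norm_sum_rieszWeight_smul_le (a := fun i : Fin N => (a i : ℝ)) (fun i => a.abs_le i)
    (f := fun t => f (extendTrue t)) fun _ => hf _

theorem norm_sum_rieszAverage_update_sub_le {f : (ℕ → Bool) → StrongDual ℝ X} {C : ℝ}
    (hf : ∀ t, ‖f t‖ ≤ C) (a c : RieszCoeff) (σ : ℕ → ℝ) (N : ℕ) :
    ‖∑ k ∈ Finset.range N, σ k • (rieszAverage f (Function.update a k (c k)) N
      - rieszAverage f a N)‖ ≤ 2 * C * √(∑ k ∈ Finset.range N, σ k ^ 2) := by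
  have hC : 0 ≤ C := (norm_nonneg _).trans (hf fun _ => true)
  have h := norm_sum_smul_rieszWeight_update_sub_le (a := fun i : Fin N => (a i : ℝ))
    (c := fun i : Fin N => (c i : ℝ)) (fun i => a.abs_le i) (fun i => c.abs_le i)
    (fun i => σ i) hC (f := fun t => f (extendTrue t)) fun _ => hf _
  rw [Finset.sum_range, Finset.sum_range]
  simpa only [rieszAverage, coe_update_comp_val] using h

theorem rieszAverage_apply {f : (ℕ → Bool) → StrongDual ℝ X} {e : ℕ → X}
    (hfe : ∀ t n, f t (e n) = boolSign (t n)) (a : RieszCoeff) {n N : ℕ} (hn : n < N) :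
    rieszAverage f a N (e n) = a n := by
  have h := sum_rieszWeight_mul_boolSign (a := fun i : Fin N => (a i : ℝ))
    (fun i => a.abs_le i) ⟨n, hn⟩
  simpa [rieszAverage, hfe, extendTrue, hn] using h

/-- The limit of the finite averages is taken along one ultrafilter for all `a`, so estimates on
their differences survive. -/
theorem ContainsEllOne.exists_rieszFunctionals (hX : ContainsEllOne X) :
    ∃ (e : ℕ → X) (H : RieszCoeff → StrongDual ℝ X) (C : ℝ),
      (∀ n, ‖e n‖ ≤ C) ∧ (∀ a, ‖H a‖ ≤ C) ∧ (∀ a n, H a (e n) = a n) ∧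
      ∀ (a c : RieszCoeff) (σ : ℕ → ℝ) (N : ℕ),
        ‖∑ k ∈ Finset.range N, σ k • (H (Function.update a k (c k)) - H a)‖ ≤
          C * √(∑ k ∈ Finset.range N, σ k ^ 2) := by
  obtain ⟨e, f, C, he, hf, hfe⟩ := hX.exists_signs
  have hC : 0 ≤ C := (norm_nonneg _).trans (hf fun _ => true)
  choose H hHC hH using fun a : RieszCoeff =>
    exists_tendsto_hyperfilter (rieszAverage f a) (norm_rieszAverage_le hf a)
  refine ⟨e, H, 2 * C, fun n => (he n).trans (by linarith), fun a => (hHC a).trans (by linarith),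
    fun a n => ?_, fun a c σ N => ?_⟩
  · refine tendsto_nhds_unique (hH a (e n)) (tendsto_const_nhds.congr' ?_)
    refine Nat.hyperfilter_le_atTop ?_
    filter_upwards [Filter.eventually_gt_atTop n] with N hN
    exact (rieszAverage_apply hfe a hN).symm
  · refine ContinuousLinearMap.opNorm_le_bound _ (by positivity) fun x => ?_
    have hlim : Filter.Tendsto (fun M => (∑ k ∈ Finset.range N,
        σ k • (rieszAverage f (Function.update a k (c k)) M - rieszAverage f a M)) x)
        (Filter.hyperfilter ℕ) (𝓝 ((∑ k ∈ Finset.range N,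
          σ k • (H (Function.update a k (c k)) - H a)) x)) := by
      simp only [sum_apply, smul_apply, sub_apply]
      exact tendsto_finsetSum _ fun k _ => ((hH _ x).sub (hH a x)).const_smul (σ k)
    refine le_of_tendsto hlim.norm (Nat.hyperfilter_le_atTop ?_)
    filter_upwards [Filter.eventually_ge_atTop N] with M hM
    have hsub : Finset.range N ⊆ Finset.range M := Finset.range_mono hM
    -- Truncating `σ` at `N` makes the bound at every level `M ≥ N` independent of `M`.
    have h := norm_sum_rieszAverage_update_sub_le hf a c (fun k => if k < N then σ k else 0) M
    rw [← Finset.sum_subset hsub fun k _ hk => by simp [Finset.mem_range.not.1 hk],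
      ← Finset.sum_subset (f := fun k => (if k < N then σ k else 0) ^ 2) hsub
        fun k _ hk => by simp [Finset.mem_range.not.1 hk],
      Finset.sum_congr rfl fun k hk => by rw [if_pos (Finset.mem_range.1 hk)],
      Finset.sum_congr (g := fun k => σ k ^ 2) rfl
        fun k hk => by rw [if_pos (Finset.mem_range.1 hk)]] at h
    exact ContinuousLinearMap.le_of_opNorm_le _ h x

end RieszAverage

/-! ### Splitting off a mean by Hahn–Banach -/

section HahnBanach

variable {X : Type*} [NormedAddCommGroup X] [NormedSpace ℝ X] {I : Type*}

/-- Evaluation of a bounded family of functionals, as a bounded function on the index set. -/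
def familyEval (h : I → StrongDual ℝ X) {C : ℝ} (hC : ∀ i, ‖h i‖ ≤ C) :
    X →ₗ[ℝ] lp (fun _ : I => ℝ) ⊤ where
  toFun x := ⟨fun i => h i x, memℓp_infty ⟨C * ‖x‖, by
    rintro _ ⟨i, rfl⟩
    exact (h i).le_of_opNorm_le (hC i) x⟩⟩
  map_add' x y := by ext i; exact map_add (h i) x y
  map_smul' r x := by ext i; simp

theorem lp_bddAbove_range (g : lp (fun _ : I => ℝ) ⊤) : BddAbove (Set.range fun i => g i) :=
  ⟨‖g‖, by
    rintro _ ⟨i, rfl⟩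
    exact (le_abs_self _).trans (lp.norm_apply_le_norm ENNReal.top_ne_zero g i)⟩

/-- A functional dominated by a multiple of the norm plus the supremum of a bounded family of
functionals splits into a bounded functional and a mean over the family. -/
theorem exists_add_mean [Nonempty I] (h : I → StrongDual ℝ X) {C : ℝ} (hC : ∀ i, ‖h i‖ ≤ C)
    {η : ℝ} (hη : 0 ≤ η) (f : X →ₗ[ℝ] ℝ) (hf : ∀ x, f x ≤ η * ‖x‖ + ⨆ i, h i x) :
    ∃ (d : X →ₗ[ℝ] ℝ) (M : lp (fun _ : I => ℝ) ⊤ →ₗ[ℝ] ℝ), (∀ x, d x ≤ η * ‖x‖) ∧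
      (∀ g, M g ≤ ⨆ i, g i) ∧ ∀ x, f x = d x + M (familyEval h hC x) := by
  -- On the graph of the evaluation map, `f` is dominated by a sublinear function of the pair; an
  -- extension to the product restricts to `d` and `M` on the two factors.
  let F : (X × lp (fun _ : I => ℝ) ⊤) →ₗ.[ℝ] ℝ :=
    ⟨(familyEval h hC).graph, (f ∘ₗ LinearMap.fst ℝ X _).domRestrict _⟩
  obtain ⟨G, hGF, hG⟩ := exists_extension_of_le_sublinear F
    (fun p => η * ‖p.1‖ + ⨆ i, p.2 i)
    (by
      intro c hc p
      simp only [Prod.smul_fst, Prod.smul_snd, norm_smul, lp.coeFn_smul, Pi.smul_apply,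
        smul_eq_mul, Real.norm_of_nonneg hc.le, ← Real.mul_iSup_of_nonneg hc.le]
      ring)
    (by
      intro p q
      have h1 := norm_add_le p.1 q.1
      have h2 : ⨆ i, (p + q).2 i ≤ (⨆ i, p.2 i) + ⨆ i, q.2 i :=
        ciSup_le fun i => add_le_add (le_ciSup (lp_bddAbove_range p.2) i)
          (le_ciSup (lp_bddAbove_range q.2) i)
      have h3 := mul_le_mul_of_nonneg_left h1 hη
      simp only [Prod.fst_add] at *
      linarith)
    (by
      rintro ⟨⟨x, g⟩, hg⟩
      obtain rfl : g = familyEval h hC x := hg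
      exact hf x)
  refine ⟨G ∘ₗ LinearMap.inl ℝ X _, G ∘ₗ LinearMap.inr ℝ X _, fun x => ?_, fun g => ?_,
    fun x => ?_⟩
  · simpa using hG (x, 0)
  · simpa using hG (0, g)
  · have h1 : G (x, familyEval h hC x) = f x := hGF ⟨(x, familyEval h hC x), rfl⟩
    rw [← h1]
    simp [← map_add]

theorem mean_const [Nonempty I] {M : lp (fun _ : I => ℝ) ⊤ →ₗ[ℝ] ℝ} (hM : ∀ g, M g ≤ ⨆ i, g i)
    {g : lp (fun _ : I => ℝ) ⊤} {c : ℝ} (hg : ∀ i, g i = c) : M g = c := by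
  refine le_antisymm ((hM g).trans_eq (by simp [hg])) ?_
  have h := hM (-g)
  simp only [map_neg, lp.coeFn_neg, Pi.neg_apply, hg, ciSup_const] at h
  linarith

end HahnBanach

/-! ### Flexible families -/

/-- A bounded family of functionals whose values at a sequence of vectors can be changed
one at a time, the changes satisfying an upper `ℓ₂`-estimate. -/
structure FlexibleFamily (X : Type*) [NormedAddCommGroup X] [NormedSpace ℝ X] (I : Type) where
  vec : ℕ → X
  dual : I → StrongDual ℝ X
  bound : ℝ
  norm_vec_le : ∀ n, ‖vec n‖ ≤ bound
  norm_dual_le : ∀ i, ‖dual i‖ ≤ bound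
  exists_neg : ∀ i, ∃ j, dual j = -dual i
  modify : RieszCoeff → ℕ → I → I
  dual_modify_self : ∀ c k i, dual (modify c k i) (vec k) = c k
  dual_modify_of_ne : ∀ c k i n, n ≠ k → dual (modify c k i) (vec n) = dual i (vec n)
  norm_sum_le : ∀ c i (σ : ℕ → ℝ) N,
    ‖∑ k ∈ Finset.range N, σ k • (dual (modify c k i) - dual i)‖ ≤
      bound * √(∑ k ∈ Finset.range N, σ k ^ 2)

theorem ContainsEllOne.nonempty_flexibleFamily {X : Type*} [NormedAddCommGroup X]
    [NormedSpace ℝ X] (hX : ContainsEllOne X) :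
    Nonempty (FlexibleFamily X (RieszCoeff × Bool)) := by
  obtain ⟨e, H, C, he, hH, hHe, hsum⟩ := hX.exists_rieszFunctionals
  -- The Boolean adds a sign to make the family symmetric; targets carry the same sign so that the
  -- signed functional takes the value `c k`.
  let c' : RieszCoeff → Bool → RieszCoeff := fun c s k =>
    if s then c k else ⟨-c k, by have := (c k).2; constructor <;> linarith [this.1, this.2]⟩
  have hc' : ∀ c s k, boolSign s * c' c s k = c k := by
    intro c s k
    cases s <;> simp [boolSign, c']
  refine ⟨{ vec := e, dual := fun i => boolSign i.2 • H i.1, bound := C, norm_vec_le := he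
            norm_dual_le := fun i => ?_, exists_neg := fun i => ⟨(i.1, !i.2), ?_⟩
            modify := fun c k i => (Function.update i.1 k (c' c i.2 k), i.2)
            dual_modify_self := fun c k i => ?_, dual_modify_of_ne := fun c k i n hn => ?_
            norm_sum_le := fun c i σ N => ?_ }⟩
  · rw [norm_smul, Real.norm_eq_abs, abs_boolSign, one_mul]
    exact hH _
  · rcases i with ⟨a, s⟩
    ext x
    cases s <;> simp [boolSign]
  · simp [hHe, hc']
  · simp [hHe, hn]
  · have h := hsum i.1 (c' c i.2) (fun k => σ k * boolSign i.2) N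
    simp only [mul_pow, sq (boolSign _), boolSign_mul_self, mul_one] at h
    refine le_of_eq_of_le (congrArg _ (Finset.sum_congr rfl fun k _ => ?_)) h
    ext x
    simp
    ring

theorem LinearMap.abs_le_of_le_mul_norm {X : Type*} [NormedAddCommGroup X] [NormedSpace ℝ X]
    {f : X →ₗ[ℝ] ℝ} {K : ℝ} (hf : ∀ x, f x ≤ K * ‖x‖) (x : X) : |f x| ≤ K * ‖x‖ := by
  refine abs_le.2 ⟨?_, hf x⟩
  have h := hf (-x)
  rw [map_neg, norm_neg] at h
  linarith

/-! ### The renorming -/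

namespace FlexibleFamily

variable {X : Type*} [NormedAddCommGroup X] [NormedSpace ℝ X] {I : Type}
  (𝓕 : FlexibleFamily X I)

/-- The weight of the original norm in the renorming. -/
def scale : ℝ := 1 / (4 * (𝓕.bound + 1))

theorem bound_nonneg : 0 ≤ 𝓕.bound := (norm_nonneg _).trans (𝓕.norm_vec_le 0)

theorem scale_pos : 0 < 𝓕.scale := by
  have := 𝓕.bound_nonneg
  unfold scale
  positivity

theorem scale_mul_bound_le : 𝓕.scale * 𝓕.bound ≤ 1 / 4 := by
  have := 𝓕.bound_nonneg
  rw [scale, div_mul_eq_mul_div, div_le_div_iff₀ (by positivity) (by norm_num)]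
  linarith

theorem dual_le (i : I) (x : X) : 𝓕.dual i x ≤ 𝓕.bound * ‖x‖ :=
  (le_abs_self _).trans ((𝓕.dual i).le_of_opNorm_le (𝓕.norm_dual_le i) x)

theorem bddAbove_dual (x : X) : BddAbove (Set.range fun i => 𝓕.dual i x) :=
  ⟨𝓕.bound * ‖x‖, by rintro _ ⟨i, rfl⟩; exact 𝓕.dual_le i x⟩

/-- A sublinear majorant, equivalent to the norm. -/
def majorant (x : X) : ℝ := 𝓕.scale * ‖x‖ + ⨆ i, 𝓕.dual i x

theorem majorant_le [Nonempty I] (x : X) : 𝓕.majorant x ≤ (𝓕.scale + 𝓕.bound) * ‖x‖ := by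
  have h : ⨆ i, 𝓕.dual i x ≤ 𝓕.bound * ‖x‖ := ciSup_le fun i => 𝓕.dual_le i x
  rw [majorant, add_mul]
  linarith

theorem majorant_neg_le [Nonempty I] (x : X) : 𝓕.majorant (-x) ≤ 𝓕.majorant x := by
  unfold majorant
  rw [norm_neg]
  refine add_le_add_right (ciSup_le fun i => ?_) _
  obtain ⟨j, hj⟩ := 𝓕.exists_neg i
  have h : 𝓕.dual i (-x) = 𝓕.dual j x := by simp [hj]
  rw [h]
  exact le_ciSup (𝓕.bddAbove_dual x) j

theorem scale_mul_norm_le_majorant [Nonempty I] (x : X) : 𝓕.scale * ‖x‖ ≤ 𝓕.majorant x := by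
  refine le_add_of_nonneg_right ?_
  obtain ⟨i⟩ := ‹Nonempty I›
  obtain ⟨j, hj⟩ := 𝓕.exists_neg i
  have h1 := le_ciSup (𝓕.bddAbove_dual x) i
  have h2 := le_ciSup (𝓕.bddAbove_dual x) j
  simp only [hj, neg_apply] at h2
  linarith

/-- The dual unit ball of the renorming. -/
def dualBall : Set (StrongDual ℝ X) :=
  {f | (∀ x, f x ≤ 𝓕.majorant x) ∧ ∀ n, |f (𝓕.vec n)| ≤ 1 / 4}

/-- Every element of the dual ball is approximated, in the weak topology, by elements taking the
largest possible value at one of the vectors of the family. -/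
theorem exists_modified [Nonempty I] {f : StrongDual ℝ X} (hf : f ∈ 𝓕.dualBall) :
    ∃ g : ℕ → StrongDual ℝ X, (∀ k, g k ∈ 𝓕.dualBall) ∧ (∀ k, g k (𝓕.vec k) = 1 / 4) ∧
      ∀ (σ : ℕ → ℝ) N, ‖∑ k ∈ Finset.range N, σ k • (g k - f)‖ ≤
        𝓕.bound * √(∑ k ∈ Finset.range N, σ k ^ 2) := by
  obtain ⟨d, M, hd, hM, hfdM⟩ :=
    exists_add_mean 𝓕.dual 𝓕.norm_dual_le 𝓕.scale_pos.le (f : X →ₗ[ℝ] ℝ) hf.1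
  have hf_eq : ∀ x, f x = d x + M (familyEval 𝓕.dual 𝓕.norm_dual_le x) := hfdM
  have hde : ∀ k, |d (𝓕.vec k)| ≤ 1 / 4 := fun k =>
    (LinearMap.abs_le_of_le_mul_norm hd _).trans
      ((mul_le_mul_of_nonneg_left (𝓕.norm_vec_le k) 𝓕.scale_pos.le).trans 𝓕.scale_mul_bound_le)
  -- The value the mean part must take for the total to be `1/4`. Since `|d| ≤ 1/4` there, it lies
  -- in `[0, 1/2]`, an admissible coefficient.
  let c : RieszCoeff := fun k => ⟨1 / 4 - d (𝓕.vec k), by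
    have := abs_le.1 (hde k)
    constructor <;> linarith [this.1, this.2]⟩
  let G : ℕ → X →ₗ[ℝ] ℝ := fun k =>
    d + M ∘ₗ familyEval (fun i => 𝓕.dual (𝓕.modify c k i)) fun i => 𝓕.norm_dual_le _
  have hG : ∀ k x, G k x = d x +
    M (familyEval (fun i => 𝓕.dual (𝓕.modify c k i)) (fun i => 𝓕.norm_dual_le _) x) :=
    fun _ _ => rfl
  have hGle : ∀ k x, G k x ≤ 𝓕.majorant x := fun k x =>
    add_le_add (hd x) ((hM _).trans (ciSup_le fun i => le_ciSup (𝓕.bddAbove_dual x) _))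
  have hGself : ∀ k, G k (𝓕.vec k) = 1 / 4 := by
    intro k
    rw [hG, mean_const hM (c := c k) fun i => 𝓕.dual_modify_self c k i]
    simp [c]
  have hGne : ∀ k n, n ≠ k → G k (𝓕.vec n) = f (𝓕.vec n) := by
    intro k n hn
    rw [hG, hf_eq]
    congr 2
    ext i
    exact 𝓕.dual_modify_of_ne c k i n hn
  refine ⟨fun k => (G k).mkContinuous (𝓕.scale + 𝓕.bound)
    (LinearMap.abs_le_of_le_mul_norm fun x => (hGle k x).trans (𝓕.majorant_le x)),
    fun k => ⟨hGle k, fun n => ?_⟩, hGself, fun σ N => ?_⟩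
  · rcases eq_or_ne n k with rfl | hn
    · exact (congrArg _ (hGself n)).trans_le (by norm_num [abs_of_pos])
    · exact (congrArg _ (hGne k n hn)).trans_le (hf.2 n)
  · refine ContinuousLinearMap.opNorm_le_bound _
      (mul_nonneg 𝓕.bound_nonneg (Real.sqrt_nonneg _))
      (LinearMap.abs_le_of_le_mul_norm (f := ((∑ k ∈ Finset.range N, σ k •
        ((G k).mkContinuous (𝓕.scale + 𝓕.bound) (LinearMap.abs_le_of_le_mul_norm fun x =>
          (hGle k x).trans (𝓕.majorant_le x)) - f) : StrongDual ℝ X) : X →ₗ[ℝ] ℝ)) fun x => ?_)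
    -- The part `d` cancels in `G k - f`, and a mean is at most the supremum, so the `ℓ₂`-estimate
    -- for each member of the family passes to the `G k`.
    let D : lp (fun _ : I => ℝ) ⊤ := ∑ k ∈ Finset.range N, σ k •
      (familyEval (fun i => 𝓕.dual (𝓕.modify c k i)) (fun i => 𝓕.norm_dual_le _) x -
        familyEval 𝓕.dual 𝓕.norm_dual_le x)
    have hD : (∑ k ∈ Finset.range N, σ k • (G k x - f x)) = M D := by
      simp only [D, map_sum, map_smul, map_sub, hG, hf_eq, add_sub_add_left_eq_sub]
    have hDi : ∀ i, D i = (∑ k ∈ Finset.range N,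
        σ k • (𝓕.dual (𝓕.modify c k i) - 𝓕.dual i)) x := by
      intro i
      rw [sum_apply]
      simp only [D, lp.coeFn_sum]
      exact Finset.sum_apply i _ _
    have hle : M D ≤ 𝓕.bound * √(∑ k ∈ Finset.range N, σ k ^ 2) * ‖x‖ := by
      refine (hM D).trans (ciSup_le fun i => ?_)
      rw [hDi]
      exact (le_abs_self _).trans
        (ContinuousLinearMap.le_of_opNorm_le _ (𝓕.norm_sum_le c i σ N) x)
    refine le_of_eq_of_le ?_ hle
    rw [← hD]
    simp

theorem abs_le_majorant [Nonempty I] {f : StrongDual ℝ X} (hf : f ∈ 𝓕.dualBall) (x : X) :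
    |f x| ≤ 𝓕.majorant x := by
  refine abs_le.2 ⟨?_, hf.1 x⟩
  have h := (hf.1 (-x)).trans (𝓕.majorant_neg_le x)
  rw [map_neg] at h
  linarith

theorem bddAbove_dualBall [Nonempty I] (x : X) :
    BddAbove (Set.range fun f : 𝓕.dualBall => |(f : StrongDual ℝ X) x|) :=
  ⟨𝓕.majorant x, by rintro _ ⟨f, rfl⟩; exact 𝓕.abs_le_majorant f.2 x⟩

theorem mem_dualBall_of_norm_le [Nonempty I] {f : StrongDual ℝ X} (hf : ‖f‖ ≤ 𝓕.scale) :
    f ∈ 𝓕.dualBall := by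
  refine ⟨fun x => ?_, fun n => ?_⟩
  · exact ((le_abs_self _).trans (f.le_of_opNorm_le hf x)).trans (𝓕.scale_mul_norm_le_majorant x)
  · exact (f.le_of_opNorm_le hf _).trans
      ((mul_le_mul_of_nonneg_left (𝓕.norm_vec_le n) 𝓕.scale_pos.le).trans 𝓕.scale_mul_bound_le)

instance [Nonempty I] : Nonempty 𝓕.dualBall :=
  ⟨⟨0, 𝓕.mem_dualBall_of_norm_le (by simpa using 𝓕.scale_pos.le)⟩⟩

/-- The renorming with dual unit ball `dualBall`. -/
def equivalentNorm [Nonempty I] : EquivalentNorm X where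
  toSeminorm := Seminorm.of (fun x => ⨆ f : 𝓕.dualBall, |(f : StrongDual ℝ X) x|)
    (fun x y => ciSup_le fun f => by
      rw [map_add]
      exact (abs_add_le _ _).trans (add_le_add (le_ciSup (𝓕.bddAbove_dualBall x) f)
        (le_ciSup (𝓕.bddAbove_dualBall y) f)))
    (fun a x => by
      simp only [map_smul, smul_eq_mul, abs_mul, Real.norm_eq_abs]
      exact (Real.mul_iSup_of_nonneg (abs_nonneg a) _).symm)
  exists_lower := by
    refine ⟨𝓕.scale, 𝓕.scale_pos, fun x => ?_⟩
    obtain ⟨g, hg, hgx⟩ := exists_dual_vector'' ℝ x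
    have hmem : 𝓕.scale • g ∈ 𝓕.dualBall := 𝓕.mem_dualBall_of_norm_le (by
      rw [norm_smul, Real.norm_of_nonneg 𝓕.scale_pos.le]
      exact mul_le_of_le_one_right 𝓕.scale_pos.le hg)
    have h := le_ciSup (𝓕.bddAbove_dualBall x) ⟨_, hmem⟩
    refine le_trans (le_of_eq ?_) ((le_abs_self _).trans h)
    simp [hgx]
  exists_upper := by
    refine ⟨𝓕.scale + 𝓕.bound, add_pos_of_pos_of_nonneg 𝓕.scale_pos 𝓕.bound_nonneg, fun x => ?_⟩
    exact (ciSup_le fun f => 𝓕.abs_le_majorant f.2 x).trans (𝓕.majorant_le x)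

theorem abs_le_equivalentNorm [Nonempty I] {f : StrongDual ℝ X} (hf : f ∈ 𝓕.dualBall) (x : X) :
    |f x| ≤ 𝓕.equivalentNorm.toSeminorm x :=
  le_ciSup (𝓕.bddAbove_dualBall x) ⟨f, hf⟩

/-- No bipolar argument is needed: the new norm itself obeys both bounds defining `dualBall`, so
anything below it does too. -/
theorem mem_dualBall_of_abs_le [Nonempty I] {f : StrongDual ℝ X}
    (hf : ∀ x, |f x| ≤ 𝓕.equivalentNorm.toSeminorm x) : f ∈ 𝓕.dualBall :=
  ⟨fun x => (le_abs_self _).trans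
      ((hf x).trans (ciSup_le fun g => 𝓕.abs_le_majorant g.2 x)),
    fun n => (hf _).trans (ciSup_le fun g => g.2.2 n)⟩

end FlexibleFamily

/-! ### Peaking sequences and the ball topology -/

/-- Every functional in the dual unit ball of `Z` is approximated, in the weak topology of the
dual, by functionals of the dual unit ball with value `1` at some vector `v k` of the unit ball. -/
def HasPeakingSequence (Z : Type*) [NormedAddCommGroup Z] [NormedSpace ℝ Z] : Prop :=
  ∃ v : ℕ → Z, (∀ n, ‖v n‖ ≤ 1) ∧ ∀ f : StrongDual ℝ Z, ‖f‖ ≤ 1 →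
    ∃ (g : ℕ → StrongDual ℝ Z) (K : ℝ), (∀ k, ‖g k‖ ≤ 1) ∧ (∀ k, g k (v k) = 1) ∧
      ∀ (σ : ℕ → ℝ) N, ‖∑ k ∈ Finset.range N, σ k • (g k - f)‖ ≤
        K * √(∑ k ∈ Finset.range N, σ k ^ 2)

theorem FlexibleFamily.hasPeakingSequence {X : Type*} [NormedAddCommGroup X] [NormedSpace ℝ X]
    {I : Type} [Nonempty I] (𝓕 : FlexibleFamily X I) :
    HasPeakingSequence (Renormed 𝓕.equivalentNorm) := by
  let e := Renormed.equiv 𝓕.equivalentNorm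
  have hnorm : ∀ z, ‖z‖ = 𝓕.equivalentNorm.toSeminorm (e.symm z) := fun _ => rfl
  refine ⟨fun n => e ((4 : ℝ) • 𝓕.vec n), fun n => ?_, fun f hf => ?_⟩
  · rw [hnorm, e.symm_apply_apply, map_smul_eq_mul, Real.norm_of_nonneg (by norm_num)]
    have h : 𝓕.equivalentNorm.toSeminorm (𝓕.vec n) ≤ 1 / 4 := ciSup_le fun g => g.2.2 n
    linarith
  obtain ⟨C, hC, hpC⟩ := 𝓕.equivalentNorm.exists_upper
  obtain ⟨c, hc, hpc⟩ := 𝓕.equivalentNorm.exists_lower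
  have hfp : ∀ x, |f (e x)| ≤ 𝓕.equivalentNorm.toSeminorm x := fun x =>
    (f.le_of_opNorm_le hf (e x)).trans_eq (one_mul _)
  let f' : StrongDual ℝ X := ((f : Renormed 𝓕.equivalentNorm →ₗ[ℝ] ℝ) ∘ₗ
    (e : X →ₗ[ℝ] Renormed 𝓕.equivalentNorm)).mkContinuous C fun x => (hfp x).trans (hpC x)
  obtain ⟨g, hg, hgv, hsum⟩ := 𝓕.exists_modified (𝓕.mem_dualBall_of_abs_le (f := f') hfp)
  let g' : ℕ → StrongDual ℝ (Renormed 𝓕.equivalentNorm) := fun k =>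
    ((g k : X →ₗ[ℝ] ℝ) ∘ₗ (e.symm : Renormed 𝓕.equivalentNorm →ₗ[ℝ] X)).mkContinuous 1 fun z => by
      rw [one_mul]
      exact 𝓕.abs_le_equivalentNorm (hg k) (e.symm z)
  refine ⟨g', 𝓕.bound / c, fun k => LinearMap.mkContinuous_norm_le _ zero_le_one _, fun k => ?_,
    fun σ N => ?_⟩
  · have h : g' k (e ((4 : ℝ) • 𝓕.vec k)) = g k ((4 : ℝ) • 𝓕.vec k) := rfl
    rw [h, map_smul, hgv]
    norm_num
  · have hnn : 0 ≤ 𝓕.bound * √(∑ k ∈ Finset.range N, σ k ^ 2) :=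
      mul_nonneg 𝓕.bound_nonneg (Real.sqrt_nonneg _)
    rw [div_mul_eq_mul_div]
    refine ContinuousLinearMap.opNorm_le_bound _ (div_nonneg hnn hc.le) fun z => ?_
    have h : (∑ k ∈ Finset.range N, σ k • (g' k - f)) z =
        (∑ k ∈ Finset.range N, σ k • (g k - f')) (e.symm z) := by
      simp only [sum_apply, smul_apply, sub_apply]
      rfl
    rw [h]
    refine (ContinuousLinearMap.le_of_opNorm_le _ (hsum σ N) _).trans ?_
    rw [div_mul_eq_mul_div, le_div_iff₀ hc, mul_assoc]
    refine mul_le_mul_of_nonneg_left ?_ hnn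
    rw [mul_comm]
    exact hpc _

/-- Testing with `σ k = x (g k - f)` bounds the partial sums `s` of squares by `‖x‖ K √s`, so the
values are square summable. -/
theorem tendsto_bidual_of_norm_sum_le {Z : Type*} [NormedAddCommGroup Z] [NormedSpace ℝ Z]
    {f : StrongDual ℝ Z} {g : ℕ → StrongDual ℝ Z} {K : ℝ}
    (h : ∀ (σ : ℕ → ℝ) N, ‖∑ k ∈ Finset.range N, σ k • (g k - f)‖ ≤
      K * √(∑ k ∈ Finset.range N, σ k ^ 2)) (x : Bidual Z) :
    Filter.Tendsto (fun k => x (g k - f)) Filter.atTop (𝓝 0) := by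
  have hbound : ∀ N, ∑ k ∈ Finset.range N, x (g k - f) ^ 2 ≤ (‖x‖ * K) ^ 2 := by
    intro N
    set s := ∑ k ∈ Finset.range N, x (g k - f) ^ 2 with hs
    have hs0 : 0 ≤ s := Finset.sum_nonneg fun k _ => sq_nonneg _
    have h1 : s = x (∑ k ∈ Finset.range N, x (g k - f) • (g k - f)) := by
      simp only [map_sum, map_smul, smul_eq_mul, hs, sq]
    have h2 : s ≤ ‖x‖ * K * √s := by
      rw [h1]
      refine (le_abs_self _).trans ((x.le_opNorm _).trans ?_)
      rw [mul_assoc, ← h1]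
      exact mul_le_mul_of_nonneg_left (h _ N) (norm_nonneg _)
    have h3 : √s ^ 2 = s := Real.sq_sqrt hs0
    nlinarith [sq_nonneg (√s - ‖x‖ * K), Real.sqrt_nonneg s]
  have hsum := summable_of_sum_range_le (fun k => sq_nonneg (x (g k - f))) hbound
  have hsqrt := (Real.continuous_sqrt.tendsto 0).comp hsum.tendsto_atTop_zero
  rw [Real.sqrt_zero] at hsqrt
  rw [tendsto_zero_iff_abs_tendsto_zero]
  exact hsqrt.congr fun k => Real.sqrt_sq_eq_abs _

theorem exists_norm_le_one_lt_apply {Z : Type*} [NormedAddCommGroup Z] [NormedSpace ℝ Z]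
    (x : StrongDual ℝ Z) {r : ℝ} (hr : r < ‖x‖) : ∃ z : Z, ‖z‖ ≤ 1 ∧ r < x z := by
  by_contra! hcon
  have hr0 : 0 ≤ r := by simpa using hcon 0 (by simp)
  refine hr.not_ge (x.opNorm_le_bound hr0 (LinearMap.abs_le_of_le_mul_norm
    (f := (x : Z →ₗ[ℝ] ℝ)) fun z => ?_))
  rcases eq_or_ne z 0 with rfl | hz
  · simp
  · have hz' : 0 < ‖z‖ := norm_pos_iff.2 hz
    have h := hcon (‖z‖⁻¹ • z) (by rw [norm_smul, norm_inv, norm_norm, inv_mul_cancel₀ hz'.ne'])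
    rw [map_smul, smul_eq_mul, inv_mul_le_iff₀ hz', mul_comm] at h
    exact h

/-- The functionals `f` and `g k` depend on `q` but the vectors `v k` do not, so one large `k`
serves all of the finite set. -/
theorem HasPeakingSequence.exists_far {Z : Type*} [NormedAddCommGroup Z] [NormedSpace ℝ Z]
    (hZ : HasPeakingSequence Z) {S : Set (Bidual Z × ℝ)} (hS : S.Finite)
    (hlt : ∀ q ∈ S, q.2 < ‖q.1‖ + 1) :
    ∃ u : Bidual Z, ‖u‖ ≤ 1 ∧ ∀ q ∈ S, q.2 < ‖u - q.1‖ := by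
  obtain ⟨v, hv, hpeak⟩ := hZ
  have key : ∀ q ∈ S, ∀ᶠ k in Filter.atTop,
      q.2 < ‖NormedSpace.inclusionInDoubleDual ℝ Z (v k) - q.1‖ := by
    intro q hq
    obtain ⟨f, hf, hfx⟩ := exists_norm_le_one_lt_apply (-q.1) (r := q.2 - 1) (by
      rw [norm_neg]
      linarith [hlt q hq])
    obtain ⟨g, K, hg, hgv, hsum⟩ := hpeak f hf
    have hev := (tendsto_bidual_of_norm_sum_le hsum (-q.1)).eventually
      (lt_mem_nhds (show q.2 - 1 - (-q.1) f < 0 by linarith))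
    filter_upwards [hev] with k hk
    rw [map_sub] at hk
    have h1 : (NormedSpace.inclusionInDoubleDual ℝ Z (v k) - q.1) (g k) = 1 + (-q.1) (g k) := by
      rw [sub_apply, NormedSpace.dual_def, hgv, neg_apply, sub_eq_add_neg]
    have h2 := (le_abs_self _).trans
      ((NormedSpace.inclusionInDoubleDual ℝ Z (v k) - q.1).unit_le_opNorm (g k) (hg k))
    rw [h1] at h2
    linarith
  obtain ⟨k, hk⟩ := ((Filter.eventually_all_finite hS).2 key).exists
  exact ⟨_, (NormedSpace.double_dual_bound ℝ Z (v k)).trans (hv k), hk⟩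

/-- A nonempty open set of the unit ball, in the ball topology, contains every point of the unit
ball lying outside a suitable finite union of balls, none of which covers the unit ball. -/
theorem exists_finite_of_isOpen_unitBallTopology {E : Type*} [NormedAddCommGroup E]
    {U : Set (Metric.closedBall (0 : E) 1)} (hU : IsOpen[unitBallTopology E] U)
    (hne : U.Nonempty) :
    ∃ S : Set (E × ℝ), S.Finite ∧ (∀ q ∈ S, q.2 < ‖q.1‖ + 1) ∧
      ∀ u : Metric.closedBall (0 : E) 1, (∀ q ∈ S, q.2 < ‖(u : E) - q.1‖) → u ∈ U := by
  obtain ⟨V, hV, rfl⟩ := hU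
  obtain ⟨z, hz⟩ := hne
  let := ballTopology E
  have hbasis := TopologicalSpace.isTopologicalBasis_of_subbasis (t := ballTopology E) rfl
  obtain ⟨_, ⟨s, ⟨hsfin, hs⟩, rfl⟩, hzs, hsV⟩ :=
    hbasis.exists_subset_of_mem_open (show (z : E) ∈ V from hz) hV
  choose! c r hcr using fun W (hW : W ∈ s) => hs hW
  refine ⟨(fun W => (c W, r W)) '' s, hsfin.image _, ?_, fun u hu => hsV fun W hW => ?_⟩
  · rintro _ ⟨W, hW, rfl⟩
    have hzW := hzs W hW
    rw [hcr W hW, Set.mem_compl_iff, Metric.mem_closedBall, dist_eq_norm, not_le] at hzW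
    have hz1 := mem_closedBall_zero_iff.1 z.2
    linarith [norm_sub_le (z : E) (c W)]
  · rw [hcr W hW, Set.mem_compl_iff, Metric.mem_closedBall, dist_eq_norm, not_le]
    exact hu _ ⟨W, hW, rfl⟩

theorem mem_bidual_unitBall {Z : Type*} [NormedAddCommGroup Z] [NormedSpace ℝ Z]
    {u : Bidual Z} (hu : ‖u‖ ≤ 1) : u ∈ Metric.closedBall (0 : Bidual Z) 1 :=
  (mem_closedBall_zero_iff (E := StrongDual ℝ (StrongDual ℝ Z))).2 hu

theorem HasPeakingSequence.inter_nonempty {Z : Type*} [NormedAddCommGroup Z] [NormedSpace ℝ Z]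
    (hZ : HasPeakingSequence Z) {U V : Set (Metric.closedBall (0 : Bidual Z) 1)}
    (hU : IsOpen[unitBallTopology (Bidual Z)] U) (hV : IsOpen[unitBallTopology (Bidual Z)] V)
    (hUne : U.Nonempty) (hVne : V.Nonempty) : (U ∩ V).Nonempty := by
  obtain ⟨S, hS, hSlt, hSU⟩ := exists_finite_of_isOpen_unitBallTopology hU hUne
  obtain ⟨T, hT, hTlt, hTV⟩ := exists_finite_of_isOpen_unitBallTopology hV hVne
  obtain ⟨u, hu, huST⟩ := hZ.exists_far (hS.union hT) fun q hq => hq.elim (hSlt q) (hTlt q)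
  exact ⟨⟨u, mem_bidual_unitBall hu⟩, hSU _ fun q hq => huST q (.inl hq),
    hTV _ fun q hq => huST q (.inr hq)⟩

theorem HasPeakingSequence.not_t2Space {Z : Type*} [NormedAddCommGroup Z] [NormedSpace ℝ Z]
    (hZ : HasPeakingSequence Z) :
    ¬ @T2Space (Metric.closedBall (0 : Bidual Z) 1) (unitBallTopology (Bidual Z)) := by
  intro hT2
  -- Excluding the ball of radius `0` about `0` yields a second point of the unit ball to separate
  -- from `0`.
  obtain ⟨u, hu, hu0⟩ := hZ.exists_far (Set.finite_singleton ((0 : Bidual Z), (0 : ℝ)))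
    (by rintro q rfl; positivity)
  have hne : (⟨u, mem_bidual_unitBall hu⟩ : Metric.closedBall (0 : Bidual Z) 1) ≠
      ⟨0, by simp⟩ := by
    intro h
    have hu_eq : u = 0 := congrArg Subtype.val h
    have h0 : (0 : ℝ) < ‖u - 0‖ := hu0 _ rfl
    exact norm_sub_pos_iff.1 h0 hu_eq
  obtain ⟨U, V, hU, hV, hxU, hyV, hdisj⟩ := hT2.t2 hne
  exact (hZ.inter_nonempty hU hV ⟨_, hxU⟩ ⟨_, hyV⟩).ne_empty hdisj.inter_eq

end

theorem corollary4p6 {X : Type*} [NormedAddCommGroup X] [NormedSpace ℝ X] [CompleteSpace X]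
    [TopologicalSpace.SeparableSpace X] (hX : ContainsEllOne X) :
    ∃ p : EquivalentNorm X,
      (¬ @T2Space (Metric.closedBall (0 : Bidual (Renormed p)) 1)
          (unitBallTopology (Bidual (Renormed p)))) ∧
      ∀ U V : Set (Metric.closedBall (0 : Bidual (Renormed p)) 1),
        IsOpen[unitBallTopology (Bidual (Renormed p))] U →
        IsOpen[unitBallTopology (Bidual (Renormed p))] V →
        U.Nonempty → V.Nonempty → (U ∩ V).Nonempty := by
  obtain ⟨𝓕⟩ := hX.nonempty_flexibleFamily
  have : Nonempty (RieszCoeff × Bool) := ⟨fun _ => ⟨0, by norm_num⟩, true⟩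
  have hp := 𝓕.hasPeakingSequence
  exact ⟨𝓕.equivalentNorm, hp.not_t2Space, fun U V hU hV hUne hVne =>
    hp.inter_nonempty hU hV hUne hVne⟩
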